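/- Let $\mathcal H,\mathcal H'$ be separable complex Hilbert spaces and let $(X,\mathcal M,\mu)$ be a $\sigma$-finite complete measure space such that $L^2(X)$ is separable. A closed subspace $V\subset L^2(X;\mathcal H)$ is multiplication-invariant (MI) if $\phi f\in V$ for all $f\in V$, $\phi\in L^\infty(X)$; a bounded linear operator $T:V\to V'$ between MI spaces is an MI operator if $T(\phi f)=\phi\,Tf$ for all $f\in V$, $\phi\in L^\infty(X)$. A measurable range function is a map $J$ from $X$ to the closed subspaces of $\mathcal H$ such that $x\mapsto\langle P_J(x)u,v\rangle$ is measurable for all $u,v\in\mathcal H$, where $P_J(x)$ is the orthogonal projection onto $J(x)$; it is a range function of $V$ if $V=\{f\in L^2(X;\mathcal H): f(x)\in J(x)\text{ for a.e. }x\}$. A bounded measurable range operator $R:J\to J'$ is a choice of linear operators $R(x):J(x)\to J'(x)$, $x\in X$, such that $\operatorname{ess\,sup}_x\|R(x)\|_{op}<\infty$ and $x\mapsto\langle R(x)P_J(x)u,v\rangle$ is measurable for all $u\in\mathcal H$, $v\in\mathcal H'$; it is a range operator of $T$ if, for every $f\in V$, $(Tf)(x)=R(x)[f(x)]$ for a.e.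 $x$. **Theorem.** Let $V\subset L^2(X;\mathcal H)$ and $V'\subset L^2(X;\mathcal H')$ be MI spaces with measurable range functions $J$ and $J'$, let $T:V\to V'$ be an MI operator, and let $R:J\to J'$ be a bounded measurable range operator of $T$. Then: 1. $\|T\|_{op}=\operatorname{ess\,sup}_{x\in X}\|R(x)\|_{op}$. 2. For every $C>0$: $\|Tf\|\ge C\|f\|$ for all $f\in V$ if and only if, for a.e. $x\in X$, $\|R(x)v\|\ge C\|v\|$ for all $v\in J(x)$. 3. $T$ is invertible if and only if $R(x)$ is invertible for a.e. $x$ and $\operatorname{ess\,sup}_{x\in X}\|R(x)^{-1}\|_{op}<\infty$. In this case $T^{-1}$ is an MI operator with range operator $x\mapsto R(x)^{-1}$. 4. $T^*:V'\to V$ is an MI operator with range operator $x\mapsto R(x)^*$. 5. $T$ is unitary if and only if $R(x)$ is unitary for a.e. $x$. 6. If $V=V'$ and $J=J'$, then $T$ is normal if and only if $R(x)$ is normal for a.e. $x$. 7. $T$ is injective if and only if $R(x)$ is injective for a.e. $x$. 8. $T$ is an isometry if and only if $R(x)$ is an isometry for a.e. $x$. 9. $T$ is a partial isometry if and only if $R(x)$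 is a partial isometry for a.e. $x$. In 3 and 4, the range operators $x\mapsto R(x)^{-1}$ and $x\mapsto R(x)^*$ are defined for a.e. $x$ and are set to $0$ on the exceptional null set. -/

import Mathlib

open MeasureTheory
open scoped ENNReal InnerProductSpace

noncomputable section

namespace MI

/-! ### Linear maps between Hilbert spaces -/

section LinearMaps

variable {E F : Type*} [NormedAddCommGroup E] [InnerProductSpace ℂ E]
  [NormedAddCommGroup F] [InnerProductSpace ℂ F]

/-- The operator norm `sup {‖A v‖ : ‖v‖ ≤ 1}` of a linear map, equal to `∞` if `A` is unbounded. -/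
def opENorm (A : E →ₗ[ℂ] F) : ℝ≥0∞ := ⨆ (v : E) (_ : ‖v‖ ≤ 1), ‖A v‖ₑ

open Classical in
/-- The inverse of a bijective linear map (by convention `0` if `A` is not bijective). -/
def inv (A : E →ₗ[ℂ] F) : F →ₗ[ℂ] E :=
  if h : Function.Bijective A then ((LinearEquiv.ofBijective A h).symm : F →ₗ[ℂ] E) else 0

open Classical in
/-- The Hilbert space adjoint of a bounded linear map (by convention `0` if `A` is unbounded). -/
def adj [CompleteSpace E] [CompleteSpace F] (A : E →ₗ[ℂ] F) : F →ₗ[ℂ] E :=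
  if h : Continuous A then
    (ContinuousLinearMap.adjoint (⟨A, h⟩ : E →L[ℂ] F) : F →ₗ[ℂ] E) else 0

/-- `A` is bounded from below with constant `C`. -/
def BoundedBelowBy (C : ℝ) (A : E →ₗ[ℂ] F) : Prop := ∀ v : E, C * ‖v‖ ≤ ‖A v‖

/-- `A` is a unitary operator from `E` onto `F`. -/
def IsUnitaryMap (A : E →ₗ[ℂ] F) : Prop := ∃ U : E ≃ₗᵢ[ℂ] F, ∀ v : E, U v = A v

/-- `A` is a bounded normal operator on `E`. -/
def IsNormalMap [CompleteSpace E] (A : E →ₗ[ℂ] E) : Prop :=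
  ∃ B : E →L[ℂ] E, (B : E →ₗ[ℂ] E) = A ∧ IsStarNormal B

/-- `A` is a partial isometry: it is isometric on the orthogonal complement of its kernel. -/
def IsPartialIsometryMap (A : E →ₗ[ℂ] F) : Prop := ∀ v ∈ (LinearMap.ker A)ᗮ, ‖A v‖ = ‖v‖

end LinearMaps

section Spaces

variable {X : Type*} [MeasurableSpace X]
  {H : Type*} [NormedAddCommGroup H] [InnerProductSpace ℂ H] [CompleteSpace H]
  {H' : Type*} [NormedAddCommGroup H'] [InnerProductSpace ℂ H'] [CompleteSpace H']

/-! ### Multiplication-invariant spaces and operators -/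

variable (H) in
/-- A multiplication-invariant (MI) space: a closed subspace of `L²(X; H)` that is stable under
multiplication by every `φ ∈ L^∞(X)`. -/
structure MISpace (μ : Measure X) extends ClosedSubmodule ℂ (Lp H 2 μ) where
  mul_mem' : ∀ (φ : Lp ℂ ∞ μ) (f : Lp H 2 μ), f ∈ carrier → (φ • f : Lp H 2 μ) ∈ carrier

variable {μ : Measure X}

/-- The Hilbert space underlying an MI space. -/
abbrev MISpace.sub (V : MISpace H μ) : Submodule ℂ (Lp H 2 μ) := V.toSubmodule

instance (V : MISpace H μ) : CompleteSpace V.sub := V.isClosed'.completeSpace_coe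

/-- The operator `f ↦ φ f` of multiplication by `φ ∈ L^∞(X)`, on an MI space. -/
def MISpace.mul (V : MISpace H μ) (φ : Lp ℂ ∞ μ) (f : V.sub) : V.sub :=
  ⟨(φ • (f : Lp H 2 μ) : Lp H 2 μ), V.mul_mem' φ f f.2⟩

/-- A bounded linear operator between MI spaces is an MI operator if it commutes with
multiplication by every `φ ∈ L^∞(X)`. -/
def IsMIOperator {V : MISpace H μ} {V' : MISpace H' μ} (T : V.sub →L[ℂ] V'.sub) : Prop :=
  ∀ (φ : Lp ℂ ∞ μ) (f : V.sub), T (V.mul φ f) = V'.mul φ (T f)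

/-! ### Range functions and range operators -/

variable (X H) in
/-- A range function: a choice of a closed subspace `J x` of `H` for every `x`. -/
abbrev RangeFunction := X → ClosedSubmodule ℂ H

/-- The Hilbert space `J x`. -/
abbrev RangeFunction.fiber (J : RangeFunction X H) (x : X) : Submodule ℂ H := (J x).toSubmodule

instance (J : RangeFunction X H) (x : X) : CompleteSpace (J.fiber x) :=
  (J x).isClosed'.completeSpace_coe

/-- The orthogonal projection `P_J(x)` of `H` onto `J x`. -/
def RangeFunction.proj (J : RangeFunction X H) (x : X) (u : H) : J.fiber x :=
  (J.fiber x).orthogonalProjectionOnto u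

/-- `J` is measurable if `x ↦ ⟪P_J(x) u, v⟫` is measurable for all `u, v ∈ H`. -/
def RangeFunction.IsMeasurable (J : RangeFunction X H) : Prop :=
  ∀ u v : H, Measurable fun x => ⟪(J.proj x u : H), v⟫_ℂ

variable (μ) in
/-- The set `V_J` of all `f ∈ L²(X; H)` with `f x ∈ J x` for a.e. `x`. -/
def RangeFunction.sections (J : RangeFunction X H) : Set (Lp H 2 μ) :=
  {f | ∀ᵐ x ∂μ, f x ∈ J x}

/-- `J` is a (measurable) range function of the MI space `V`, i.e. `V = V_J`. -/
def MISpace.HasRangeFunction (V : MISpace H μ) (J : RangeFunction X H) : Prop :=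
  J.IsMeasurable ∧ (V.sub : Set (Lp H 2 μ)) = J.sections μ

/-- A range operator from `J` to `J'`: a choice of a linear operator `J x → J' x` for every `x`. -/
abbrev RangeOperator (J : RangeFunction X H) (J' : RangeFunction X H') :=
  ∀ x : X, J.fiber x →ₗ[ℂ] J'.fiber x

variable {J : RangeFunction X H} {J' : RangeFunction X H'}

variable (μ) in
/-- `R` is bounded: the essential supremum of the operator norms of `R x` is finite. -/
def RangeOperator.IsBounded (R : RangeOperator J J') : Prop :=
  essSup (fun x => opENorm (R x)) μ < ∞

/-- `R` is measurable if `x ↦ ⟪R x (P_J(x) u), v⟫` is measurable for all `u ∈ H`, `v ∈ H'`. -/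
def RangeOperator.IsMeasurable (R : RangeOperator J J') : Prop :=
  ∀ (u : H) (v : H'), Measurable fun x => ⟪(R x (J.proj x u) : H'), v⟫_ℂ

/-- `R` is a bounded measurable range operator and `T` is its direct integral:
`(T f) x = R x (f x)` for a.e. `x`, for every `f` in the domain of `T`. -/
def HasRangeOperator {V : MISpace H μ} {V' : MISpace H' μ} (T : V.sub →L[ℂ] V'.sub)
    (R : RangeOperator J J') : Prop :=
  R.IsBounded μ ∧ R.IsMeasurable ∧
    ∀ f : V.sub, ∀ᵐ x ∂μ, ∃ h : (f : Lp H 2 μ) x ∈ J.fiber x,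
      (T f : Lp H' 2 μ) x = R x ⟨(f : Lp H 2 μ) x, h⟩

end Spaces

end MI

end

noncomputable section

namespace MI

set_option linter.unusedSectionVars false

open Filter Topology ContinuousLinearMap

/-! ### Bounded operators on one Hilbert space: norms, inverses, kernel projections -/

section LinearMaps

variable {E F : Type*} [NormedAddCommGroup E] [InnerProductSpace ℂ E]
  [NormedAddCommGroup F] [InnerProductSpace ℂ F]

/-! Everything rests on one comparison principle, `Decomposes.norm_le_iff`: for operators `T`, `S`
acting fibrewise by `R`, `Q`, one has `‖T f‖ ≤ ‖S f‖` for all `f` exactly when almost every fibre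
satisfies the same inequality. Multiplying `f` by indicators localizes the inequality to almost
every point, and countably many sections with dense values make the null set independent of the
vector.

Each property is then rewritten as a norm comparison between operators built from `T`: normality is
`‖T f‖ = ‖T* f‖`, unitarity says that `T` and `T*` are isometric, and with `P` the projection onto
the kernel, injectivity is `P = 0` and being a partial isometry is `‖T f‖ = ‖f - P f‖`.
Invertibility combines a lower bound for `T` with injectivity of `T*`.

It remains to see that `T*` and `P` act fibrewise by the adjoints and the kernel projections of `R
x`. For `T*` this follows by localizing the adjoint identity. For `P`, the mean ergodic theorem
gives a strong limit of polynomials in `T* T`, which avoids a measurable selection of kernel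
vectors. -/

lemma opENorm_le_iff {A : E →ₗ[ℂ] F} {c : ℝ} (hc : 0 ≤ c) :
    opENorm A ≤ ENNReal.ofReal c ↔ ∀ v, ‖A v‖ ≤ c * ‖v‖ := by
  simp only [opENorm, iSup_le_iff, ← ofReal_norm,
    ENNReal.ofReal_le_ofReal_iff hc]
  refine ⟨fun h v => ?_, fun h v hv => (h v).trans (mul_le_of_le_one_right hc hv)⟩
  rcases eq_or_ne v 0 with rfl | hv
  · simp
  have hv' : 0 < ‖v‖ := norm_pos_iff.2 hv
  have := h (((‖v‖⁻¹ : ℝ) : ℂ) • v) (by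
    rw [norm_smul, Complex.norm_real, norm_inv, norm_norm, inv_mul_cancel₀ hv'.ne'])
  rwa [map_smul, norm_smul, Complex.norm_real, norm_inv, norm_norm, inv_mul_le_iff₀ hv',
    mul_comm] at this

lemma continuous_of_norm_le {A : E →ₗ[ℂ] F} {c : ℝ} (h : ∀ v, ‖A v‖ ≤ c * ‖v‖) :
    Continuous A :=
  (A.mkContinuous c h).continuous

lemma continuous_of_opENorm_lt_top {A : E →ₗ[ℂ] F} (h : opENorm A < ∞) : Continuous A :=
  continuous_of_norm_le ((opENorm_le_iff ENNReal.toReal_nonneg).1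
    (ENNReal.ofReal_toReal h.ne).ge)

lemma inv_apply_apply {A : E →ₗ[ℂ] F} (h : Function.Bijective A) (v : E) : inv A (A v) = v := by
  rw [inv, dif_pos h]
  exact (LinearEquiv.ofBijective A h).symm_apply_apply v

lemma apply_inv_apply {A : E →ₗ[ℂ] F} (h : Function.Bijective A) (w : F) : A (inv A w) = w := by
  rw [inv, dif_pos h]
  exact (LinearEquiv.ofBijective A h).apply_symm_apply w

variable [CompleteSpace E] [CompleteSpace F]

lemma continuous_adj (A : E →ₗ[ℂ] F) : Continuous (adj A) := by
  unfold adj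
  split_ifs with h
  · exact (adjoint (⟨A, h⟩ : E →L[ℂ] F)).continuous
  · exact continuous_zero

lemma adj_coe (A : E →L[ℂ] F) : adj (A : E →ₗ[ℂ] F) = (adjoint A : F →ₗ[ℂ] E) :=
  dif_pos A.continuous

lemma inner_adj {A : E →ₗ[ℂ] F} (hA : Continuous A) (v : E) (w : F) :
    ⟪v, adj A w⟫_ℂ = ⟪A v, w⟫_ℂ := by
  rw [adj, dif_pos hA]
  exact adjoint_inner_right (⟨A, hA⟩ : E →L[ℂ] F) v w

/-- A bounded operator that is bounded below together with its adjoint is bijective. -/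
lemma bijective_of_boundedBelow {A : E →L[ℂ] F} {c : ℝ} (hc : 0 < c)
    (h : ∀ v, c * ‖v‖ ≤ ‖A v‖) (h' : ∀ w, adjoint A w = 0 → w = 0) : Function.Bijective A := by
  rw [bijective_iff_dense_range_and_antilipschitz]
  refine ⟨?_, _, A.antilipschitz_of_bound (K := Real.toNNReal c⁻¹) fun v => ?_⟩
  · rw [Submodule.topologicalClosure_eq_top_iff, orthogonal_range, Submodule.eq_bot_iff]
    exact h'
  · rw [Real.coe_toNNReal _ (inv_nonneg.2 hc.le), ← div_eq_inv_mul, le_div_iff₀ hc, mul_comm]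
    exact h v

/-- The orthogonal projection onto the kernel of a bounded operator. -/
def kerProjL (A : E →L[ℂ] F) : E →L[ℂ] E := A.ker.starProjection

lemma apply_kerProjL (A : E →L[ℂ] F) (v : E) : A (kerProjL A v) = 0 :=
  A.ker.starProjection_apply_mem v

open Classical in
/-- The orthogonal projection onto the kernel of a bounded linear map (by convention `0` if the
map is unbounded). -/
def kerProj (A : E →ₗ[ℂ] F) : E →ₗ[ℂ] E :=
  if h : Continuous A then (kerProjL ⟨A, h⟩ : E →ₗ[ℂ] E) else 0

lemma kerProj_coe (A : E →L[ℂ] F) :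
    kerProj (A : E →ₗ[ℂ] F) = (kerProjL A : E →ₗ[ℂ] E) :=
  dif_pos A.continuous

/-- Splitting off the kernel component removes the restriction on `v`, leaving an equality of norms
that can be compared fibrewise. -/
lemma isPartialIsometryMap_iff (A : E →L[ℂ] F) :
    IsPartialIsometryMap (A : E →ₗ[ℂ] F) ↔ ∀ v, ‖A v‖ = ‖v - kerProjL A v‖ := by
  have key : ∀ v, A (v - kerProjL A v) = A v := fun v => by
    rw [map_sub, apply_kerProjL, sub_zero]
  refine ⟨fun h v => ?_, fun h v hv => ?_⟩
  · exact (congrArg _ (key v).symm).trans (h _ (A.ker.sub_starProjection_mem_orthogonal v))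
  · have : kerProjL A v = 0 := A.ker.starProjection_apply_eq_zero_iff.2 hv
    simpa [this] using h v

/-- `1 - A* A / c` is a contraction with fixed space `ker A`, if `‖A‖² ≤ c`. -/
def contr (c : ℝ) (A : E →L[ℂ] F) : E →L[ℂ] E := 1 - ((c⁻¹ : ℝ) : ℂ) • (adjoint A ∘L A)

lemma norm_contr_le {c : ℝ} (hc : 0 < c) {A : E →L[ℂ] F} (hA : ‖A‖ ^ 2 ≤ c) :
    ‖contr c A‖ ≤ 1 := by
  refine opNorm_le_bound _ zero_le_one fun v => ?_
  rw [one_mul, ← sq_le_sq₀ (norm_nonneg _) (norm_nonneg _)]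
  have h1 : contr c A v = v - ((c⁻¹ : ℝ) : ℂ) • adjoint A (A v) := rfl
  have h2 : ‖adjoint A (A v)‖ ^ 2 ≤ c * ‖A v‖ ^ 2 := by
    refine le_trans ?_ (mul_le_mul_of_nonneg_right hA (sq_nonneg _))
    rw [← mul_pow]
    have := (adjoint A).le_opNorm (A v)
    rw [LinearIsometryEquiv.norm_map] at this
    gcongr
  have h3 : RCLike.re ⟪v, adjoint A (A v)⟫_ℂ = ‖A v‖ ^ 2 := by
    rw [adjoint_inner_right]
    exact inner_self_eq_norm_sq (A v)
  have h6 : ∀ z : ℂ, RCLike.re (((c⁻¹ : ℝ) : ℂ) * z) = c⁻¹ * RCLike.re z :=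
    fun z => RCLike.re_ofReal_mul _ _
  rw [h1, @norm_sub_sq ℂ, inner_smul_right, h6, h3, norm_smul,
    Complex.norm_real, mul_pow, Real.norm_of_nonneg (inv_nonneg.2 hc.le)]
  -- The quadratic term of the expansion absorbs at most half of the cross term `2 * c⁻¹ * ‖A v‖ ^
  -- 2`.
  have h4 : c⁻¹ ^ 2 * ‖adjoint A (A v)‖ ^ 2 ≤ c⁻¹ * ‖A v‖ ^ 2 := by
    calc _ ≤ c⁻¹ ^ 2 * (c * ‖A v‖ ^ 2) := by gcongr
      _ = _ := by field_simp
  have h5 : 0 ≤ c⁻¹ * ‖A v‖ ^ 2 := by positivity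
  linarith

lemma contr_apply_eq_self_iff {c : ℝ} (hc : 0 < c) (A : E →L[ℂ] F) (v : E) :
    contr c A v = v ↔ A v = 0 := by
  have h1 : contr c A v = v - ((c⁻¹ : ℝ) : ℂ) • adjoint A (A v) := rfl
  have h2 : adjoint A (A v) = 0 ↔ A v = 0 := by
    have := A.ker_adjoint_comp_self
    exact SetLike.ext_iff.1 this v
  rw [h1, sub_eq_self, smul_eq_zero, h2]
  simp [hc.ne']

/-- Ergodic averages of the contraction `1 - A* A / c` converge to the projection onto `ker A`. -/
lemma tendsto_ergodic {c : ℝ} (hc : 0 < c) {A : E →L[ℂ] F} (hA : ‖A‖ ^ 2 ≤ c) (v : E) :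
    Tendsto (fun n : ℕ => ((n : ℂ)⁻¹ • ∑ k ∈ Finset.range n, contr c A ^ k) v) atTop
      (𝓝 (kerProjL A v)) := by
  have h := (contr c A).tendsto_birkhoffAverage_orthogonalProjection (norm_contr_le hc hA) v
  have hk : (contr c A).eqLocus (1 : E →L[ℂ] E) = A.ker := by
    ext w
    exact contr_apply_eq_self_iff hc A w
  have hp : (((contr c A).eqLocus (1 : E →L[ℂ] E)).orthogonalProjectionOnto v : E) =
      kerProjL A v := by
    rw [kerProjL, ← Submodule.coe_orthogonalProjectionOnto_apply]
    congr!
  rw [hp] at h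
  refine h.congr fun n => ?_
  simp [birkhoffAverage, birkhoffSum]

end LinearMaps

/-! ### From weak to strong measurability of the projections -/

lemma measurable_of_dist {X E : Type*} [MeasurableSpace X] [PseudoMetricSpace E]
    [SecondCountableTopology E] [MeasurableSpace E] [BorelSpace E] {f : X → E}
    (h : ∀ a, Measurable fun x => dist (f x) a) : Measurable f := by
  have hb : TopologicalSpace.IsTopologicalBasis
      {s : Set E | ∃ a r, s = Metric.ball a r} := by
    refine TopologicalSpace.isTopologicalBasis_of_isOpen_of_nhds ?_ fun a u ha hu => ?_
    · rintro _ ⟨a, r, rfl⟩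
      exact Metric.isOpen_ball
    · obtain ⟨r, hr, hu⟩ := Metric.isOpen_iff.1 hu a ha
      exact ⟨_, ⟨a, r, rfl⟩, Metric.mem_ball_self hr, hu⟩
  rw [‹BorelSpace E›.measurable_eq, hb.borel_eq_generateFrom]
  refine measurable_generateFrom ?_
  rintro _ ⟨a, r, rfl⟩
  exact h a measurableSet_Iio

section Spaces

variable {X : Type*} [MeasurableSpace X]
  {H : Type*} [NormedAddCommGroup H] [InnerProductSpace ℂ H] [CompleteSpace H]

lemma RangeFunction.proj_of_mem (J : RangeFunction X H) {x : X} (v : J.fiber x) :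
    J.proj x v = v :=
  (J.fiber x).orthogonalProjectionOnto_mem_subspace_eq_self v

lemma RangeFunction.IsMeasurable.stronglyMeasurable_proj [TopologicalSpace.SeparableSpace H]
    {J : RangeFunction X H} (hJ : J.IsMeasurable) (u : H) :
    StronglyMeasurable fun x => (J.proj x u : H) := by
  borelize H
  have : SecondCountableTopology H := UniformSpace.secondCountable_of_separable H
  refine Measurable.stronglyMeasurable (measurable_of_dist fun a => ?_)
  -- Since `⟪P u, u⟫ = ‖P u‖ ^ 2`, the distance involves only scalar products whose measurability is
  -- assumed.
  have : ∀ x, dist (J.proj x u : H) a = Real.sqrt (RCLike.re ⟪(J.proj x u : H), u⟫_ℂ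
      - 2 * RCLike.re ⟪(J.proj x u : H), a⟫_ℂ + ‖a‖ ^ 2) := fun x => by
    have h : ⟪(J.proj x u : H), u⟫_ℂ = ⟪(J.proj x u : H), (J.proj x u : H)⟫_ℂ :=
      (Submodule.inner_orthogonalProjectionOnto_eq_of_mem_left (J.proj x u) u).symm
    rw [dist_eq_norm, h, inner_self_eq_norm_sq, ← @norm_sub_sq ℂ, Real.sqrt_sq (norm_nonneg _)]
  simp only [this]
  have h1 := RCLike.measurable_re.comp (hJ u u)
  have h2 := RCLike.measurable_re.comp (hJ u a)
  exact ((h1.sub (h2.const_mul 2)).add_const _).sqrt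

end Spaces

/-! ### Sections of an MI space and the algebra of fibrewise operators -/

section Decomposition

variable {X : Type*} [MeasurableSpace X] {μ : Measure X}
  {H : Type*} [NormedAddCommGroup H] [InnerProductSpace ℂ H] [CompleteSpace H]
  {H' : Type*} [NormedAddCommGroup H'] [InnerProductSpace ℂ H'] [CompleteSpace H']
  {H'' : Type*} [NormedAddCommGroup H''] [InnerProductSpace ℂ H''] [CompleteSpace H'']
  {V : MISpace H μ} {V' : MISpace H' μ} {V'' : MISpace H'' μ}
  {J : RangeFunction X H} {J' : RangeFunction X H'} {J'' : RangeFunction X H''}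

lemma MISpace.HasRangeFunction.mem_iff (hJ : V.HasRangeFunction J) {f : Lp H 2 μ} :
    f ∈ V.sub ↔ ∀ᵐ x ∂μ, f x ∈ J.fiber x :=
  Set.ext_iff.1 hJ.2 f

lemma MISpace.HasRangeFunction.ae_mem (hJ : V.HasRangeFunction J) (f : V.sub) :
    ∀ᵐ x ∂μ, (f : Lp H 2 μ) x ∈ J.fiber x :=
  hJ.mem_iff.1 f.2

lemma MISpace.exists_indicator (V : MISpace H μ) {s : Set X} (hs : MeasurableSet s) (f : V.sub) :
    ∃ g : V.sub, (g : Lp H 2 μ) =ᵐ[μ] s.indicator (f : Lp H 2 μ) := by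
  have hφ : MemLp (s.indicator fun _ => (1 : ℂ)) ∞ μ := (memLp_top_const 1).indicator hs
  refine ⟨V.mul hφ.toLp f, ?_⟩
  filter_upwards [Lp.coeFn_lpSMul (r := 2) hφ.toLp (f : Lp H 2 μ), hφ.coeFn_toLp] with x h1 h2
  refine h1.trans ?_
  rw [Pi.smul_apply', h2]
  by_cases hx : x ∈ s <;> simp [hx]

/-- The field `x ↦ P_J(x) u` is bounded but need not be square integrable, so it is cut off to sets
of finite measure exhausting `X`. -/
lemma exists_sections_proj [SigmaFinite μ] [TopologicalSpace.SeparableSpace H]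
    (hJ : V.HasRangeFunction J) (u : H) :
    ∃ F : ℕ → V.sub, ∀ᵐ x ∂μ, ∀ n, (F n : Lp H 2 μ) x =
      (spanningSets μ n).indicator (fun x => (J.proj x u : H)) x := by
  have hm : ∀ n, MemLp ((spanningSets μ n).indicator fun x => (J.proj x u : H)) 2 μ := fun n => by
    have h1 : MemLp ((spanningSets μ n).indicator fun _ => ‖u‖) 2 μ :=
      memLp_indicator_const 2 (measurableSet_spanningSets μ n) _
        (Or.inr (measure_spanningSets_lt_top μ n).ne)
    refine h1.mono ((hJ.1.stronglyMeasurable_proj u).aestronglyMeasurable.indicator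
      (measurableSet_spanningSets μ n)) (ae_of_all _ fun x => ?_)
    by_cases hx : x ∈ spanningSets μ n
    · simpa [hx, RangeFunction.proj] using (J.fiber x).norm_orthogonalProjectionOnto_apply_le u
    · simp [hx]
  have hV : ∀ n, (hm n).toLp ∈ V.sub := fun n => by
    rw [hJ.mem_iff]
    filter_upwards [(hm n).coeFn_toLp] with x hx
    rw [hx]
    by_cases hx : x ∈ spanningSets μ n
    · simp [hx]
    · simp [hx]
  refine ⟨fun n => ⟨_, hV n⟩, ae_all_iff.2 fun n => (hm n).coeFn_toLp⟩

/-- A countable family of sections whose values are dense in almost every fibre. -/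
lemma exists_denseRange_sections [SigmaFinite μ] [TopologicalSpace.SeparableSpace H]
    (hJ : V.HasRangeFunction J) :
    ∃ F : ℕ × ℕ → V.sub, ∀ᵐ x ∂μ, ∃ h : ∀ n, (F n : Lp H 2 μ) x ∈ J.fiber x,
      DenseRange fun n => (⟨(F n : Lp H 2 μ) x, h n⟩ : J.fiber x) := by
  have : Nonempty H := ⟨0⟩
  choose F hF using fun m => exists_sections_proj hJ (TopologicalSpace.denseSeq H m)
  refine ⟨fun p => F p.1 p.2, ?_⟩
  filter_upwards [ae_all_iff.2 hF, ae_all_iff.2 fun p : ℕ × ℕ => hJ.ae_mem (F p.1 p.2)]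
    with x hx hmem
  refine ⟨hmem, ?_⟩
  have hd : DenseRange fun m => J.proj x (TopologicalSpace.denseSeq H m) :=
    DenseRange.comp (g := (J.fiber x).orthogonalProjectionOnto)
      (Function.Surjective.denseRange fun v => ⟨v, J.proj_of_mem v⟩)
      (TopologicalSpace.denseRange_denseSeq H) (ContinuousLinearMap.continuous _)
  refine hd.mono ?_
  rintro _ ⟨m, rfl⟩
  refine ⟨(m, spanningSetsIndex μ x), Subtype.ext ?_⟩
  refine (hx m _).trans ?_
  rw [Set.indicator_of_mem (mem_spanningSetsIndex μ x)]

/-- `T` acts fibrewise by the linear maps `R x`, almost all of which are bounded. -/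
def Decomposes (T : V.sub →L[ℂ] V'.sub) (R : RangeOperator J J') : Prop :=
  (∀ᵐ x ∂μ, Continuous (R x)) ∧
    ∀ f : V.sub, ∀ᵐ x ∂μ, ∃ h : (f : Lp H 2 μ) x ∈ J.fiber x,
      (T f : Lp H' 2 μ) x = R x ⟨(f : Lp H 2 μ) x, h⟩

/-- Measurability and uniform boundedness can be forgotten here: `Decomposes.hasRangeOperator`
recovers both. -/
lemma HasRangeOperator.decomposes {T : V.sub →L[ℂ] V'.sub} {R : RangeOperator J J'}
    (h : HasRangeOperator T R) : Decomposes T R := by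
  refine ⟨?_, h.2.2⟩
  filter_upwards [ENNReal.ae_le_essSup fun x => opENorm (R x)] with x hx
  exact continuous_of_opENorm_lt_top (hx.trans_lt h.1)

namespace Decomposes

variable {T T₁ T₂ : V.sub →L[ℂ] V'.sub} {R R₁ R₂ : RangeOperator J J'}

lemma isMIOperator (h : Decomposes T R) : IsMIOperator T := by
  intro φ f
  refine Subtype.ext (Lp.ext ?_)
  filter_upwards [h.2 (V.mul φ f), h.2 f, Lp.coeFn_lpSMul (r := 2) φ (f : Lp H 2 μ),
    Lp.coeFn_lpSMul (r := 2) φ (T f : Lp H' 2 μ)] with x h1 h2 h3 h4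
  obtain ⟨m1, h1⟩ := h1
  obtain ⟨m2, h2⟩ := h2
  refine h1.trans (Eq.trans ?_ h4.symm)
  rw [Pi.smul_apply', h2, ← Submodule.coe_smul, ← map_smul]
  congr 2
  exact Subtype.ext h3

lemma ae_apply (h : Decomposes T R) (f : V.sub) : ∀ᵐ x ∂μ, ∀ hm : (f : Lp H 2 μ) x ∈ J.fiber x,
    (T f : Lp H' 2 μ) x = R x ⟨(f : Lp H 2 μ) x, hm⟩ :=
  (h.2 f).mono fun _ hx _ => hx.2

lemma indicator (h : Decomposes T R) {s : Set X} {f g : V.sub}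
    (hg : (g : Lp H 2 μ) =ᵐ[μ] s.indicator (f : Lp H 2 μ)) :
    (T g : Lp H' 2 μ) =ᵐ[μ] s.indicator (T f : Lp H' 2 μ) := by
  filter_upwards [h.2 f, h.2 g, hg] with x hf hg' hx
  obtain ⟨m1, h1⟩ := hf
  obtain ⟨m2, h2⟩ := hg'
  rw [h2]
  by_cases hs : x ∈ s
  · rw [Set.indicator_of_mem hs] at hx ⊢
    rw [h1]
    congr 2
    exact Subtype.ext hx
  · rw [Set.indicator_of_notMem hs] at hx ⊢
    rw [show (⟨_, m2⟩ : J.fiber x) = 0 from Subtype.ext hx, map_zero, Submodule.coe_zero]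

lemma one (hJ : V.HasRangeFunction J) :
    Decomposes (1 : V.sub →L[ℂ] V.sub) (fun _ => LinearMap.id : RangeOperator J J) :=
  ⟨ae_of_all _ fun _ => continuous_id, fun f => (hJ.ae_mem f).mono fun _ hx => ⟨hx, rfl⟩⟩

lemma zero (hJ : V.HasRangeFunction J) :
    Decomposes (0 : V.sub →L[ℂ] V'.sub) (fun _ => 0 : RangeOperator J J') := by
  refine ⟨ae_of_all _ fun _ => continuous_zero, fun f => ?_⟩
  filter_upwards [hJ.ae_mem f, Lp.coeFn_zero H' 2 μ] with x hx h0
  exact ⟨hx, h0⟩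

lemma smul (h : Decomposes T R) (c : ℂ) :
    Decomposes (c • T) (fun x => c • R x : RangeOperator J J') := by
  refine ⟨h.1.mono fun x hx => hx.const_smul c, fun f => ?_⟩
  filter_upwards [h.2 f, Lp.coeFn_smul c (T f : Lp H' 2 μ)] with x ⟨hm, hx⟩ hc
  refine ⟨hm, hc.trans ?_⟩
  rw [Pi.smul_apply, hx]
  rfl

lemma add (h₁ : Decomposes T₁ R₁) (h₂ : Decomposes T₂ R₂) :
    Decomposes (T₁ + T₂) (fun x => R₁ x + R₂ x : RangeOperator J J') := by
  refine ⟨by filter_upwards [h₁.1, h₂.1] with x a b using a.add b, fun f => ?_⟩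
  filter_upwards [h₁.2 f, h₂.2 f, Lp.coeFn_add (T₁ f : Lp H' 2 μ) (T₂ f : Lp H' 2 μ)]
    with x ⟨hm, h1⟩ ⟨_, h2⟩ hc
  refine ⟨hm, hc.trans ?_⟩
  rw [Pi.add_apply, h1, h2]
  rfl

lemma sub (h₁ : Decomposes T₁ R₁) (h₂ : Decomposes T₂ R₂) :
    Decomposes (T₁ - T₂) (fun x => R₁ x - R₂ x : RangeOperator J J') := by
  refine ⟨by filter_upwards [h₁.1, h₂.1] with x a b using a.sub b, fun f => ?_⟩
  filter_upwards [h₁.2 f, h₂.2 f, Lp.coeFn_sub (T₁ f : Lp H' 2 μ) (T₂ f : Lp H' 2 μ)]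
    with x ⟨hm, h1⟩ ⟨_, h2⟩ hc
  refine ⟨hm, hc.trans ?_⟩
  rw [Pi.sub_apply, h1, h2]
  rfl

lemma comp {S : V'.sub →L[ℂ] V''.sub} {Q : RangeOperator J' J''} (hS : Decomposes S Q)
    (hT : Decomposes T R) : Decomposes (S ∘L T) (fun x => Q x ∘ₗ R x : RangeOperator J J'') := by
  refine ⟨by filter_upwards [hS.1, hT.1] with x a b using a.comp b, fun f => ?_⟩
  filter_upwards [hS.2 (T f), hT.2 f] with x ⟨hm, h1⟩ ⟨hm', h2⟩
  refine ⟨hm', h1.trans ?_⟩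
  simp only [LinearMap.comp_apply]
  congr 2
  exact Subtype.ext h2

lemma pow (hJ : V.HasRangeFunction J) {S : V.sub →L[ℂ] V.sub} {Q : RangeOperator J J}
    (h : Decomposes S Q) (k : ℕ) : Decomposes (S ^ k) (fun x => Q x ^ k : RangeOperator J J) := by
  induction k with
  | zero => exact one hJ
  | succ k ih =>
    simp only [pow_succ]
    exact ih.comp h

lemma sum (hJ : V.HasRangeFunction J) {S : ℕ → V.sub →L[ℂ] V'.sub} {Q : ℕ → RangeOperator J J'}
    (h : ∀ k, Decomposes (S k) (Q k)) (n : ℕ) :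
    Decomposes (∑ k ∈ Finset.range n, S k)
      (fun x => ∑ k ∈ Finset.range n, Q k x : RangeOperator J J') := by
  induction n with
  | zero => simpa using zero hJ
  | succ n ih =>
    simp only [Finset.sum_range_succ]
    exact ih.add (h n)

/-- The fibres of a strong limit of decomposable operators are the strong limits of the fibres. -/
lemma of_tendsto {S : ℕ → V.sub →L[ℂ] V'.sub} {Q : ℕ → RangeOperator J J'}
    (h : ∀ n, Decomposes (S n) (Q n)) (hR : ∀ᵐ x ∂μ, Continuous (R x))
    (hT : ∀ f, Tendsto (fun n => S n f) atTop (𝓝 (T f)))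
    (hQ : ∀ᵐ x ∂μ, ∀ v, Tendsto (fun n => Q n x v) atTop (𝓝 (R x v))) : Decomposes T R := by
  refine ⟨hR, fun f => ?_⟩
  have h1 : Tendsto (fun n => (S n f : Lp H' 2 μ)) atTop (𝓝 (T f : Lp H' 2 μ)) :=
    (continuous_subtype_val.tendsto _).comp (hT f)
  -- Convergence in `L²` gives a.e. convergence only along a subsequence, which suffices because the
  -- fibres converge along the whole sequence.
  obtain ⟨ns, hns, hlim⟩ := (tendstoInMeasure_of_tendsto_Lp h1).exists_seq_tendsto_ae
  filter_upwards [hlim, hQ, ae_all_iff.2 fun n => (h n).2 f] with x hx hQx hn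
  obtain ⟨hm, -⟩ := hn 0
  refine ⟨hm, tendsto_nhds_unique hx ?_⟩
  have h2 := (continuous_subtype_val.tendsto _).comp
    ((hQx ⟨(f : Lp H 2 μ) x, hm⟩).comp hns.tendsto_atTop)
  exact h2.congr fun n => ((hn (ns n)).2).symm

end Decomposes

end Decomposition

/-! ### Norms and inner products as integrals over measurable sets -/

section Integrals

variable {X : Type*} [MeasurableSpace X] {μ : Measure X}
  {H : Type*} [NormedAddCommGroup H] [InnerProductSpace ℂ H]

lemma integrable_norm_sq (f : Lp H 2 μ) : Integrable (fun x => ‖f x‖ ^ 2) μ :=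
  (Lp.memLp f).norm.integrable_sq

lemma norm_sq_eq_integral (f : Lp H 2 μ) : ‖f‖ ^ 2 = ∫ x, ‖f x‖ ^ 2 ∂μ := by
  have h := @L2.inner_def X H ℂ _ _ μ _ _ f f
  simp only [inner_self_eq_norm_sq_to_K] at h
  have : ∀ x, ((‖f x‖ : ℝ) : ℂ) ^ 2 = ((‖f x‖ ^ 2 : ℝ) : ℂ) := fun x => by push_cast; rfl
  simp only [Complex.coe_algebraMap, this, integral_complex_ofReal] at h
  exact_mod_cast h

lemma norm_sq_eq_setIntegral {s : Set X} (hs : MeasurableSet s) {f g : Lp H 2 μ}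
    (hg : g =ᵐ[μ] s.indicator f) : ‖g‖ ^ 2 = ∫ x in s, ‖f x‖ ^ 2 ∂μ := by
  rw [norm_sq_eq_integral, ← integral_indicator hs]
  refine integral_congr_ae ?_
  filter_upwards [hg] with x hx
  by_cases h : x ∈ s <;> simp [hx, h]

lemma inner_eq_setIntegral {s : Set X} (hs : MeasurableSet s) {f g k : Lp H 2 μ}
    (hg : g =ᵐ[μ] s.indicator f) : ⟪g, k⟫_ℂ = ∫ x in s, ⟪f x, k x⟫_ℂ ∂μ := by
  rw [L2.inner_def, ← integral_indicator hs]
  refine integral_congr_ae ?_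
  filter_upwards [hg] with x hx
  by_cases h : x ∈ s <;> simp [hx, h]

end Integrals

/-! ### Fibrewise comparison of norms; adjoints and kernel projections -/

section Comparison

variable {X : Type*} [MeasurableSpace X] {μ : Measure X} [SigmaFinite μ]
  {H : Type*} [NormedAddCommGroup H] [InnerProductSpace ℂ H] [CompleteSpace H]
  [TopologicalSpace.SeparableSpace H]
  {H' : Type*} [NormedAddCommGroup H'] [InnerProductSpace ℂ H'] [CompleteSpace H']
  {H'' : Type*} [NormedAddCommGroup H''] [InnerProductSpace ℂ H''] [CompleteSpace H'']
  {V : MISpace H μ} {V' : MISpace H' μ} {V'' : MISpace H'' μ}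
  {J : RangeFunction X H} {J' : RangeFunction X H'} {J'' : RangeFunction X H''}

namespace Decomposes

variable {T T₁ T₂ : V.sub →L[ℂ] V'.sub} {R R₁ R₂ : RangeOperator J J'}

/-- Two decomposable operators compare in norm if and only if almost all of their fibres do. -/
lemma norm_le_iff (hJ : V.HasRangeFunction J) (hT : Decomposes T R)
    {S : V.sub →L[ℂ] V''.sub} {Q : RangeOperator J J''} (hS : Decomposes S Q) :
    (∀ f, ‖T f‖ ≤ ‖S f‖) ↔ ∀ᵐ x ∂μ, ∀ v, ‖R x v‖ ≤ ‖Q x v‖ := by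
  constructor
  · intro h
    have key : ∀ f : V.sub, ∀ᵐ x ∂μ, ‖(T f : Lp H' 2 μ) x‖ ≤ ‖(S f : Lp H'' 2 μ) x‖ := by
      intro f
      -- Testing on the cut-offs of `f` compares the integrals over every measurable set, hence the
      -- integrands.
      have := ae_le_of_forall_setIntegral_le (μ := μ) (integrable_norm_sq (T f : Lp H' 2 μ))
        (integrable_norm_sq (S f : Lp H'' 2 μ)) fun s hs _ => by
          obtain ⟨g, hg⟩ := V.exists_indicator hs f
          rw [← norm_sq_eq_setIntegral hs (hT.indicator hg),
            ← norm_sq_eq_setIntegral hs (hS.indicator hg)]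
          exact pow_le_pow_left₀ (norm_nonneg _) (h g) 2
      filter_upwards [this] with x hx
      exact le_of_sq_le_sq hx (norm_nonneg _)
    obtain ⟨F, hF⟩ := exists_denseRange_sections hJ
    filter_upwards [hF, hT.1, hS.1, ae_all_iff.2 fun n => key (F n),
      ae_all_iff.2 fun n => hT.ae_apply (F n), ae_all_iff.2 fun n => hS.ae_apply (F n)]
      with x ⟨hm, hd⟩ hTc hSc hk hTa hSa v
    refine hd.induction_on (p := fun v => ‖R x v‖ ≤ ‖Q x v‖) v
      (isClosed_le hTc.norm hSc.norm) fun n => ?_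
    have := hk n
    rwa [hTa n (hm n), hSa n (hm n)] at this
  · intro h f
    rw [← sq_le_sq₀ (norm_nonneg _) (norm_nonneg _)]
    change ‖(T f : Lp H' 2 μ)‖ ^ 2 ≤ ‖(S f : Lp H'' 2 μ)‖ ^ 2
    rw [norm_sq_eq_integral, norm_sq_eq_integral]
    refine integral_mono_ae (integrable_norm_sq _) (integrable_norm_sq _) ?_
    filter_upwards [h, hT.2 f, hS.ae_apply f] with x hx ⟨hm, h1⟩ h2
    rw [h1, h2 hm]
    exact pow_le_pow_left₀ (norm_nonneg _) (hx _) 2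

lemma norm_eq_iff (hJ : V.HasRangeFunction J) (hT : Decomposes T R)
    {S : V.sub →L[ℂ] V''.sub} {Q : RangeOperator J J''} (hS : Decomposes S Q) :
    (∀ f, ‖T f‖ = ‖S f‖) ↔ ∀ᵐ x ∂μ, ∀ v, ‖R x v‖ = ‖Q x v‖ := by
  simp only [le_antisymm_iff, forall_and, eventually_and, norm_le_iff hJ hT hS,
    norm_le_iff hJ hS hT]

lemma norm_le_mul_iff (hJ : V.HasRangeFunction J) (hT : Decomposes T R) {c : ℝ} (hc : 0 ≤ c) :
    (∀ f, ‖T f‖ ≤ c * ‖f‖) ↔ ∀ᵐ x ∂μ, ∀ v, ‖R x v‖ ≤ c * ‖v‖ := by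
  have h := hT.norm_le_iff hJ ((one hJ).smul (c : ℂ))
  simp only [_root_.smul_apply, LinearMap.smul_apply, norm_smul, Complex.norm_real,
    Real.norm_of_nonneg hc] at h
  exact h

lemma boundedBelowBy_iff (hJ : V.HasRangeFunction J) (hT : Decomposes T R) {c : ℝ} (hc : 0 ≤ c) :
    BoundedBelowBy c (T : V.sub →ₗ[ℂ] V'.sub) ↔ ∀ᵐ x ∂μ, BoundedBelowBy c (R x) := by
  have h := ((one hJ).smul (c : ℂ)).norm_le_iff hJ hT
  simp only [_root_.smul_apply, LinearMap.smul_apply, norm_smul, Complex.norm_real,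
    Real.norm_of_nonneg hc] at h
  exact h

lemma norm_eq_self_iff (hJ : V.HasRangeFunction J) (hT : Decomposes T R) :
    (∀ f, ‖T f‖ = ‖f‖) ↔ ∀ᵐ x ∂μ, ∀ v, ‖R x v‖ = ‖v‖ := by
  have h := hT.norm_eq_iff hJ (one hJ)
  simp only [one_apply_eq_self, LinearMap.id_apply] at h
  exact h

lemma enorm_eq (hJ : V.HasRangeFunction J) (hT : Decomposes T R) :
    ‖T‖ₑ = essSup (fun x => opENorm (R x)) μ := by
  refine le_antisymm ?_ (essSup_le_of_ae_le _ ?_)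
  · rcases eq_or_ne (essSup (fun x => opENorm (R x)) μ) ∞ with h | h
    · rw [h]; exact le_top
    · rw [← ENNReal.ofReal_toReal h, ← ofReal_norm]
      refine ENNReal.ofReal_le_ofReal (opNorm_le_bound _ ENNReal.toReal_nonneg ?_)
      refine (hT.norm_le_mul_iff hJ ENNReal.toReal_nonneg).2 ?_
      filter_upwards [ENNReal.ae_le_essSup fun x => opENorm (R x)] with x hx
      rwa [← opENorm_le_iff ENNReal.toReal_nonneg, ENNReal.ofReal_toReal h]
  · filter_upwards [(hT.norm_le_mul_iff hJ (norm_nonneg T)).1 T.le_opNorm] with x hx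
    rwa [← ofReal_norm, opENorm_le_iff (norm_nonneg T)]

/-- Localizing `⟪f, T* g⟫ = ⟪T f, g⟫` gives the identity pointwise; letting `f` run through
countably many sections with dense values determines `(T* g) x`. -/
lemma adjoint (hJ : V.HasRangeFunction J) (hJ' : V'.HasRangeFunction J') (hT : Decomposes T R) :
    Decomposes (adjoint T) (fun x => adj (R x) : RangeOperator J' J) := by
  refine ⟨ae_of_all _ fun x => continuous_adj _, fun g => ?_⟩
  have key : ∀ f : V.sub, ∀ᵐ x ∂μ, ⟪(f : Lp H 2 μ) x,
      (ContinuousLinearMap.adjoint T g : Lp H 2 μ) x⟫_ℂ =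
      ⟪(T f : Lp H' 2 μ) x, (g : Lp H' 2 μ) x⟫_ℂ := by
    intro f
    refine Integrable.ae_eq_of_forall_setIntegral_eq _ _ (L2.integrable_inner _ _)
      (L2.integrable_inner _ _) fun s hs _ => ?_
    obtain ⟨k, hk⟩ := V.exists_indicator hs f
    rw [← inner_eq_setIntegral hs hk, ← inner_eq_setIntegral hs (hT.indicator hk)]
    exact adjoint_inner_right T k g
  obtain ⟨F, hF⟩ := exists_denseRange_sections hJ
  filter_upwards [hF, hT.1, hJ.ae_mem (ContinuousLinearMap.adjoint T g), hJ'.ae_mem g,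
    ae_all_iff.2 fun n => key (F n), ae_all_iff.2 fun n => hT.ae_apply (F n)]
    with x ⟨hm, hd⟩ hTc hm1 hm2 hk hTa
  refine ⟨hm2, congrArg Subtype.val (a₁ := ⟨_, hm1⟩) ?_⟩
  refine ext_inner_left ℂ fun v => ?_
  refine hd.induction_on (p := fun v => ⟪v, (⟨_, hm1⟩ : J.fiber x)⟫_ℂ =
    ⟪v, adj (R x) ⟨_, hm2⟩⟫_ℂ) v (isClosed_eq (by fun_prop) (by fun_prop)) fun n => ?_
  have := hk n
  rw [hTa n (hm n)] at this
  rw [inner_adj hTc]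
  exact this

/-- On each spanning set the field is a.e. the image under `T` of a cut-off section, hence a.e.
measurable; completeness of `μ` upgrades this to measurable. -/
lemma isMeasurable [μ.IsComplete] (hJ : V.HasRangeFunction J) (hT : Decomposes T R) :
    R.IsMeasurable := by
  intro u v
  obtain ⟨F, hF⟩ := exists_sections_proj hJ u
  refine aemeasurable_iff_measurable (μ := μ) |>.1 ?_
  rw [← Measure.restrict_univ (μ := μ), ← iUnion_spanningSets μ, aemeasurable_iUnion_iff]
  intro n
  have h1 : AEMeasurable (fun x => ⟪(T (F n) : Lp H' 2 μ) x, v⟫_ℂ) (μ.restrict (spanningSets μ n)) :=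
    ((Lp.aestronglyMeasurable _).inner aestronglyMeasurable_const).aemeasurable.restrict
  refine h1.congr ((ae_restrict_iff' (measurableSet_spanningSets μ n)).2 ?_)
  filter_upwards [hF, hT.2 (F n)] with x hx ⟨hm, h⟩ hxn
  have hx' := hx n
  rw [Set.indicator_of_mem hxn] at hx'
  rw [h]
  congr 3
  exact Subtype.ext hx'

lemma hasRangeOperator [μ.IsComplete] (hJ : V.HasRangeFunction J) (hT : Decomposes T R) :
    HasRangeOperator T R :=
  ⟨by rw [RangeOperator.IsBounded, ← hT.enorm_eq hJ]; exact enorm_lt_top, hT.isMeasurable hJ, hT.2⟩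

lemma kerProj (hJ : V.HasRangeFunction J) (hJ' : V'.HasRangeFunction J') (hT : Decomposes T R) :
    Decomposes (kerProjL T) (fun x => kerProj (R x) : RangeOperator J J) := by
  -- One constant serves `T` and almost all fibres, as `‖R x‖ ≤ ‖T‖` a.e.; the added `1` keeps it
  -- positive when `T = 0`.
  set c : ℝ := ‖T‖ ^ 2 + 1 with hc
  have hc0 : 0 < c := by positivity
  have hcontr : Decomposes (contr c T) (fun x => LinearMap.id - ((c⁻¹ : ℝ) : ℂ) •
      (adj (R x) ∘ₗ R x) : RangeOperator J J) :=
    (one hJ).sub (((hT.adjoint hJ hJ').comp hT).smul _)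
  refine of_tendsto (fun n => (sum hJ (fun k => hcontr.pow hJ k) n).smul ((n : ℂ)⁻¹)) ?_
    (tendsto_ergodic hc0 (by linarith)) ?_
  · filter_upwards [hT.1] with x hx
    obtain ⟨A, hA⟩ : ∃ A : J.fiber x →L[ℂ] J'.fiber x, (A : _ →ₗ[ℂ] _) = R x := ⟨⟨R x, hx⟩, rfl⟩
    rw [← hA, kerProj_coe]
    exact (kerProjL A).continuous
  · filter_upwards [hT.1, (hT.norm_le_mul_iff hJ (norm_nonneg T)).1 T.le_opNorm] with x hx hn v
    obtain ⟨A, hA⟩ : ∃ A : J.fiber x →L[ℂ] J'.fiber x, (A : _ →ₗ[ℂ] _) = R x := ⟨⟨R x, hx⟩, rfl⟩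
    rw [← hA] at hn ⊢
    have hA' : ‖A‖ ^ 2 ≤ c := by
      have : ‖A‖ ≤ ‖T‖ := opNorm_le_bound _ (norm_nonneg T) hn
      have := pow_le_pow_left₀ (norm_nonneg A) this 2
      linarith
    rw [kerProj_coe]
    refine (tendsto_ergodic hc0 hA' v).congr fun n => ?_
    rw [adj_coe]
    have h1 : LinearMap.id - ((c⁻¹ : ℝ) : ℂ) • ((ContinuousLinearMap.adjoint A : J'.fiber x →ₗ[ℂ] J.fiber x) ∘ₗ
      (A : J.fiber x →ₗ[ℂ] J'.fiber x)) = (contr c A : J.fiber x →ₗ[ℂ] J.fiber x) := rfl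
    rw [h1]
    simp [LinearMap.sum_apply, Module.End.pow_apply]

end Decomposes

end Comparison

/-! ### Operator properties expressed through norms -/

section LinearMaps

variable {E F : Type*} [NormedAddCommGroup E] [InnerProductSpace ℂ E] [CompleteSpace E]
  [NormedAddCommGroup F] [InnerProductSpace ℂ F] [CompleteSpace F]

lemma injective_iff_kerProjL (A : E →L[ℂ] F) :
    Function.Injective A ↔ ∀ v, ‖kerProjL A v‖ ≤ ‖(0 : E →L[ℂ] E) v‖ := by
  refine ⟨fun h v => ?_, fun h => (injective_iff_map_eq_zero A).2 fun v hv => ?_⟩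
  · rw [show kerProjL A v = 0 from h ((apply_kerProjL A v).trans (map_zero A).symm), norm_zero]
    exact norm_nonneg _
  · have h1 : kerProjL A v = v := A.ker.starProjection_eq_self_iff.2 hv
    have h2 := h v
    rw [h1, _root_.zero_apply, norm_zero] at h2
    exact norm_le_zero_iff.1 h2

lemma adjoint_injective_of_surjective {A : E →L[ℂ] F} (h : Function.Surjective A) :
    Function.Injective (adjoint A) := by
  refine (injective_iff_map_eq_zero _).2 fun w hw => ext_inner_left ℂ fun v => ?_
  obtain ⟨v, rfl⟩ := h v
  rw [← adjoint_inner_right, hw, inner_zero_right, inner_zero_right]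

lemma isUnitaryMap_iff (A : E →L[ℂ] F) :
    IsUnitaryMap (A : E →ₗ[ℂ] F) ↔ (∀ v, ‖A v‖ = ‖v‖) ∧ ∀ w, ‖adjoint A w‖ = ‖w‖ := by
  constructor
  · rintro ⟨U, hU⟩
    replace hU : ∀ v, U v = A v := hU
    refine ⟨fun v => by rw [← hU, U.norm_map], fun w => ?_⟩
    have : adjoint A w = U.symm w := ext_inner_left ℂ fun v => by
      rw [adjoint_inner_right, ← hU, ← U.inner_map_map v, U.apply_symm_apply]
    rw [this, U.symm.norm_map]
  · rintro ⟨h1, h2⟩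
    have hb : Function.Bijective A := bijective_of_boundedBelow one_pos
      (fun v => by rw [one_mul, h1]) fun w hw => by rw [← norm_eq_zero, ← h2, hw, norm_zero]
    exact ⟨LinearIsometryEquiv.ofSurjective ⟨(A : E →ₗ[ℂ] F), h1⟩ hb.2, fun _ => rfl⟩

lemma isNormalMap_iff (A : E →L[ℂ] E) :
    IsNormalMap (A : E →ₗ[ℂ] E) ↔ ∀ v, ‖A v‖ = ‖adjoint A v‖ := by
  rw [← isStarNormal_iff_norm_eq_adjoint]
  refine ⟨?_, fun h => ⟨A, rfl, h⟩⟩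
  rintro ⟨B, hB, h⟩
  rwa [← ContinuousLinearMap.coe_injective hB]

lemma norm_inv_le {A : E →ₗ[ℂ] F} (hA : Function.Bijective A) {c : ℝ} (hc : 0 < c)
    (h : BoundedBelowBy c A) (w : F) : ‖inv A w‖ ≤ c⁻¹ * ‖w‖ := by
  have := h (inv A w)
  rw [apply_inv_apply hA] at this
  rwa [← div_eq_inv_mul, le_div_iff₀ hc, mul_comm]

lemma boundedBelowBy_of_norm_inv_le {A : E →ₗ[ℂ] F} (hA : Function.Bijective A) {c : ℝ}
    (hc : 0 < c) (h : ∀ w, ‖inv A w‖ ≤ c * ‖w‖) : BoundedBelowBy c⁻¹ A := fun v => by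
  have := h (A v)
  rw [inv_apply_apply hA] at this
  rwa [inv_mul_le_iff₀ hc]

end LinearMaps

/-! ### Transfer of each property between `T` and its fibres -/

section Main

variable {X : Type*} [MeasurableSpace X] {μ : Measure X} [SigmaFinite μ]
  {H : Type*} [NormedAddCommGroup H] [InnerProductSpace ℂ H] [CompleteSpace H]
  [TopologicalSpace.SeparableSpace H]
  {H' : Type*} [NormedAddCommGroup H'] [InnerProductSpace ℂ H'] [CompleteSpace H']
  {V : MISpace H μ} {V' : MISpace H' μ}
  {J : RangeFunction X H} {J' : RangeFunction X H'}

namespace Decomposes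

variable {T : V.sub →L[ℂ] V'.sub} {R : RangeOperator J J'}

lemma ae_exists_coe (hT : Decomposes T R) :
    ∀ᵐ x ∂μ, ∃ A : J.fiber x →L[ℂ] J'.fiber x, R x = A :=
  hT.1.mono fun x hx => ⟨⟨R x, hx⟩, rfl⟩

lemma injective_iff (hJ : V.HasRangeFunction J) (hJ' : V'.HasRangeFunction J')
    (hT : Decomposes T R) : Function.Injective T ↔ ∀ᵐ x ∂μ, Function.Injective (R x) := by
  rw [injective_iff_kerProjL, (hT.kerProj hJ hJ').norm_le_iff hJ (zero hJ)]
  refine eventually_congr ?_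
  filter_upwards [hT.ae_exists_coe] with x ⟨A, hA⟩
  rw [hA, kerProj_coe]
  exact (injective_iff_kerProjL A).symm

lemma isometry_iff (hJ : V.HasRangeFunction J) (hT : Decomposes T R) :
    Isometry T ↔ ∀ᵐ x ∂μ, Isometry (R x) := by
  simp only [AddMonoidHomClass.isometry_iff_norm]
  exact hT.norm_eq_self_iff hJ

lemma isPartialIsometryMap_iff (hJ : V.HasRangeFunction J) (hJ' : V'.HasRangeFunction J')
    (hT : Decomposes T R) : IsPartialIsometryMap (T : V.sub →ₗ[ℂ] V'.sub) ↔
      ∀ᵐ x ∂μ, IsPartialIsometryMap (R x) := by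
  rw [MI.isPartialIsometryMap_iff]
  refine (hT.norm_eq_iff hJ ((one hJ).sub (hT.kerProj hJ hJ'))).trans (eventually_congr ?_)
  filter_upwards [hT.ae_exists_coe] with x ⟨A, hA⟩
  rw [hA, kerProj_coe, MI.isPartialIsometryMap_iff]
  rfl

lemma isStarNormal_iff (hJ : V.HasRangeFunction J) {N : V.sub →L[ℂ] V.sub}
    {Q : RangeOperator J J} (hN : Decomposes N Q) :
    IsStarNormal N ↔ ∀ᵐ x ∂μ, IsNormalMap (Q x) := by
  rw [isStarNormal_iff_norm_eq_adjoint]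
  refine (hN.norm_eq_iff hJ (hN.adjoint hJ hJ)).trans (eventually_congr ?_)
  filter_upwards [hN.ae_exists_coe] with x ⟨A, hA⟩
  rw [hA, adj_coe, isNormalMap_iff]
  rfl

variable [TopologicalSpace.SeparableSpace H']

lemma isUnitaryMap_iff (hJ : V.HasRangeFunction J) (hJ' : V'.HasRangeFunction J')
    (hT : Decomposes T R) :
    IsUnitaryMap (T : V.sub →ₗ[ℂ] V'.sub) ↔ ∀ᵐ x ∂μ, IsUnitaryMap (R x) := by
  rw [MI.isUnitaryMap_iff, hT.norm_eq_self_iff hJ, (hT.adjoint hJ hJ').norm_eq_self_iff hJ',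
    ← eventually_and]
  refine eventually_congr ?_
  filter_upwards [hT.ae_exists_coe] with x ⟨A, hA⟩
  rw [hA, adj_coe, MI.isUnitaryMap_iff]
  rfl

/-- Surjectivity of the fibres is not itself a norm comparison; it is obtained from the lower bound
and injectivity of the adjoint fibres. -/
lemma exists_boundedBelow_of_isInvertible (hJ : V.HasRangeFunction J)
    (hJ' : V'.HasRangeFunction J') (hT : Decomposes T R) (h : T.IsInvertible) :
    ∃ c : ℝ, 0 < c ∧ ∀ᵐ x ∂μ, Function.Bijective (R x) ∧ BoundedBelowBy c (R x) := by
  -- The added `1` covers trivial spaces, where the inverse has norm zero.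
  have hc : 0 < (‖T.inverse‖ + 1)⁻¹ := by positivity
  refine ⟨_, hc, ?_⟩
  have hb : BoundedBelowBy (‖T.inverse‖ + 1)⁻¹ (T : V.sub →ₗ[ℂ] V'.sub) := fun f => by
    have h1 := T.inverse.le_opNorm (T f)
    rw [h.inverse_apply_self] at h1
    rw [inv_mul_le_iff₀ (by positivity)]
    refine h1.trans ?_
    exact mul_le_mul_of_nonneg_right (le_add_of_nonneg_right zero_le_one) (norm_nonneg _)
  have hi : Function.Injective (ContinuousLinearMap.adjoint T) :=
    adjoint_injective_of_surjective fun g => ⟨_, h.self_apply_inverse g⟩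
  filter_upwards [hT.ae_exists_coe, (hT.boundedBelowBy_iff hJ hc.le).1 hb,
    ((hT.adjoint hJ hJ').injective_iff hJ' hJ).1 hi] with x ⟨A, hA⟩ h1 h2
  refine ⟨?_, h1⟩
  rw [hA] at h1 h2 ⊢
  rw [adj_coe] at h2
  exact bijective_of_boundedBelow hc h1 fun w hw => h2 (hw.trans (map_zero _).symm)

lemma inverse (hJ : V.HasRangeFunction J) (hJ' : V'.HasRangeFunction J')
    (hT : Decomposes T R) (h : T.IsInvertible) :
    Decomposes T.inverse (fun x => inv (R x) : RangeOperator J' J) := by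
  obtain ⟨c, hc, hR⟩ := hT.exists_boundedBelow_of_isInvertible hJ hJ' h
  refine ⟨hR.mono fun x hx => continuous_of_norm_le (norm_inv_le hx.1 hc hx.2), fun g => ?_⟩
  filter_upwards [hR, hT.2 (T.inverse g), hJ'.ae_mem g] with x hx ⟨hm, h1⟩ hm'
  refine ⟨hm', ?_⟩
  rw [h.self_apply_inverse] at h1
  -- The fibre formula for `T` at `T⁻¹ g` says that `R x` sends `(T⁻¹ g) x` to `g x`, so bijectivity
  -- of `R x` finishes.
  rw [show (⟨_, hm'⟩ : J'.fiber x) = R x ⟨_, hm⟩ from Subtype.ext h1, inv_apply_apply hx.1]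

lemma isInvertible_iff (hJ : V.HasRangeFunction J) (hJ' : V'.HasRangeFunction J')
    (hT : Decomposes T R) : T.IsInvertible ↔ (∀ᵐ x ∂μ, Function.Bijective (R x)) ∧
      essSup (fun x => opENorm (MI.inv (R x))) μ < ∞ := by
  constructor
  · intro h
    obtain ⟨c, hc, hR⟩ := hT.exists_boundedBelow_of_isInvertible hJ hJ' h
    refine ⟨hR.mono fun x hx => hx.1, ?_⟩
    rw [← (hT.inverse hJ hJ' h).enorm_eq hJ']
    exact enorm_lt_top
  · rintro ⟨hb, hs⟩
    set s := essSup (fun x => opENorm (MI.inv (R x))) μ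
    have hs0 : 0 < s.toReal + 1 := by positivity
    have h1 : BoundedBelowBy (s.toReal + 1)⁻¹ (T : V.sub →ₗ[ℂ] V'.sub) := by
      rw [hT.boundedBelowBy_iff hJ (inv_nonneg.2 hs0.le)]
      -- The convention `inv A = 0` for non-bijective `A` matters only on a null set, by `hb`.
      filter_upwards [hb, ENNReal.ae_le_essSup fun x => opENorm (MI.inv (R x))] with x hx hle
      refine boundedBelowBy_of_norm_inv_le hx hs0 ((opENorm_le_iff hs0.le).1 (hle.trans ?_))
      exact (ENNReal.ofReal_toReal hs.ne).ge.trans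
        (ENNReal.ofReal_le_ofReal (le_add_of_nonneg_right zero_le_one))
    have h2 : Function.Injective (ContinuousLinearMap.adjoint T) := by
      rw [(hT.adjoint hJ hJ').injective_iff hJ' hJ]
      filter_upwards [hT.ae_exists_coe, hb] with x ⟨A, hA⟩ hx
      rw [hA] at hx ⊢
      rw [adj_coe]
      exact adjoint_injective_of_surjective hx.2
    have h3 : Function.Bijective T := bijective_of_boundedBelow (inv_pos.2 hs0) h1
      fun w hw => h2 (hw.trans (map_zero _).symm)
    exact ⟨ContinuousLinearEquiv.ofBijective T (LinearMap.ker_eq_bot.2 h3.1)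
      (LinearMap.range_eq_top.2 h3.2), rfl⟩

end Decomposes

end Main

end MI

end

theorem mainTheorem2
    {X : Type*} [MeasurableSpace X] (μ : MeasureTheory.Measure X)
    [MeasureTheory.SigmaFinite μ] [μ.IsComplete]
    [TopologicalSpace.SeparableSpace (MeasureTheory.Lp ℂ 2 μ)]
    {H : Type*} [NormedAddCommGroup H] [InnerProductSpace ℂ H] [CompleteSpace H]
    [TopologicalSpace.SeparableSpace H]
    {H' : Type*} [NormedAddCommGroup H'] [InnerProductSpace ℂ H'] [CompleteSpace H']
    [TopologicalSpace.SeparableSpace H']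
    (V : MI.MISpace H μ) (V' : MI.MISpace H' μ)
    (J : MI.RangeFunction X H) (J' : MI.RangeFunction X H')
    (hJ : V.HasRangeFunction J) (hJ' : V'.HasRangeFunction J')
    (T : V.sub →L[ℂ] V'.sub) (hT : MI.IsMIOperator T)
    (R : MI.RangeOperator J J') (hR : MI.HasRangeOperator T R) :
    -- (i) norm
    (‖T‖ₑ = essSup (fun x => MI.opENorm (R x)) μ) ∧
    -- (ii) boundedness from below, with the same constant
    (∀ C : ℝ, 0 < C →
      (MI.BoundedBelowBy C (T : V.sub →ₗ[ℂ] V'.sub) ↔ ∀ᵐ x ∂μ, MI.BoundedBelowBy C (R x))) ∧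
    -- (iii) invertibility and the inverse
    (T.IsInvertible ↔
      (∀ᵐ x ∂μ, Function.Bijective (R x)) ∧
        essSup (fun x => MI.opENorm (MI.inv (R x))) μ < ∞) ∧
    (T.IsInvertible →
      MI.IsMIOperator (T.inverse : V'.sub →L[ℂ] V.sub) ∧
        MI.HasRangeOperator (T.inverse : V'.sub →L[ℂ] V.sub)
          (fun x => MI.inv (R x) : MI.RangeOperator J' J)) ∧
    -- (iv) the adjoint
    (MI.IsMIOperator (ContinuousLinearMap.adjoint T : V'.sub →L[ℂ] V.sub) ∧
      MI.HasRangeOperator (ContinuousLinearMap.adjoint T : V'.sub →L[ℂ] V.sub)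
        (fun x => MI.adj (R x) : MI.RangeOperator J' J)) ∧
    -- (v) unitary
    (MI.IsUnitaryMap (T : V.sub →ₗ[ℂ] V'.sub) ↔ ∀ᵐ x ∂μ, MI.IsUnitaryMap (R x)) ∧
    -- (vi) normal, for operators from an MI space to itself
    (∀ (N : V.sub →L[ℂ] V.sub) (Q : MI.RangeOperator J J),
      MI.IsMIOperator N → MI.HasRangeOperator N Q →
        (IsStarNormal N ↔ ∀ᵐ x ∂μ, MI.IsNormalMap (Q x))) ∧
    -- (vii) injective
    (Function.Injective T ↔ ∀ᵐ x ∂μ, Function.Injective (R x)) ∧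
    -- (viii) isometry
    (Isometry T ↔ ∀ᵐ x ∂μ, Isometry (R x)) ∧
    -- (ix) partial isometry
    (MI.IsPartialIsometryMap (T : V.sub →ₗ[ℂ] V'.sub) ↔
      ∀ᵐ x ∂μ, MI.IsPartialIsometryMap (R x)) := by
  have hD := hR.decomposes
  have hA := hD.adjoint hJ hJ'
  exact ⟨hD.enorm_eq hJ, fun C hC => hD.boundedBelowBy_iff hJ hC.le, hD.isInvertible_iff hJ hJ',
    fun h => ⟨(hD.inverse hJ hJ' h).isMIOperator, (hD.inverse hJ hJ' h).hasRangeOperator hJ'⟩,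
    ⟨hA.isMIOperator, hA.hasRangeOperator hJ'⟩, hD.isUnitaryMap_iff hJ hJ',
    fun _ _ _ hQ => hQ.decomposes.isStarNormal_iff hJ, hD.injective_iff hJ hJ',
    hD.isometry_iff hJ, hD.isPartialIsometryMap_iff hJ hJ'⟩
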